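/- Let $\mathbb{Z}(n)$ denote the cyclic group of order $n$, and let $H$ be the group $\mathbb{Z}(4)^{\omega}$ endowed with the coarsest topology that refines the product topology (each factor being discrete) and makes every group homomorphism $H\to\mathbb{Z}(2)$ continuous, where $\mathbb{Z}(2)$ is discrete. Let $G=H^{*}$ be the group of all continuous homomorphisms $H\to\mathbb{T}=\mathbb{R}/\mathbb{Z}$, with pointwise addition and the topology of pointwise convergence. A Hausdorff topological group $X$ is called minimal if every continuous bijective homomorphism from $X$ onto a Hausdorff topological group is open. The weight of a topological space is the least cardinality of a base. Then $G$ is an infinite minimal (Hausdorff) abelian topological group, and for every closed subgroup $L\le G$ such that $G/L$ is infinite, the quotient group $G/L$ has weight at least $\mathfrak{c}=2^{\aleph_0}$ and is not metrizable. In particular, there exists a minimal abelian group of which every infinite metrizable quotient group has weight $\ge\mathfrak{c}$, and there exists an infinite minimal abelian group that has no infinite metrizable quotient group. -/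

import Mathlib

open scoped Cardinal

/-- The weight of a topological space: the least cardinality of a base. -/
noncomputable def topologicalWeight (X : Type*) [TopologicalSpace X] : Cardinal :=
  sInf {κ | ∃ B : Set (Set X), TopologicalSpace.IsTopologicalBasis B ∧ #B = κ}

/-- A minimal (Hausdorff) topological group, written additively: every continuous bijective
homomorphism onto a Hausdorff topological group is open. A group that receives a bijection
from `G` has a copy in the universe of `G`, so the restriction on the universe is harmless. -/
structure IsMinimalAddGroup.{u} (G : Type u) [AddGroup G] [TopologicalSpace G] : Prop where
  isTopologicalAddGroup : IsTopologicalAddGroup G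
  t2Space : T2Space G
  isOpenMap : ∀ (K : Type u) [AddGroup K] [TopologicalSpace K] [IsTopologicalAddGroup K]
    [T2Space K] (φ : G →+ K), Continuous φ → Function.Bijective φ → IsOpenMap φ

/-- The group `A^*` of continuous characters `A → ℝ/ℤ` of a topological abelian group `A`,
to be endowed with the topology of pointwise convergence. -/
def ComfortRossDual (A : Type*) [AddCommGroup A] [TopologicalSpace A] : Type _ :=
  A →ₜ+ UnitAddCircle

namespace ComfortRossDual

variable (A : Type*) [AddCommGroup A] [TopologicalSpace A]

noncomputable instance : AddCommGroup (ComfortRossDual A) :=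
  inferInstanceAs (AddCommGroup (A →ₜ+ UnitAddCircle))

instance : FunLike (ComfortRossDual A) A UnitAddCircle :=
  inferInstanceAs (FunLike (A →ₜ+ UnitAddCircle) A UnitAddCircle)

/-- The topology of pointwise convergence. -/
instance : TopologicalSpace (ComfortRossDual A) :=
  TopologicalSpace.induced (fun (χ : ComfortRossDual A) (a : A) => χ a) inferInstance

end ComfortRossDual

/-- The abstract group `ℤ(4)^ω`. -/
def StrongZ4Power : Type := ℕ → ZMod 4

namespace StrongZ4Power

noncomputable instance : AddCommGroup StrongZ4Power :=
  inferInstanceAs (AddCommGroup (ℕ → ZMod 4))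

/-- The product topology of `ℤ(4)^ω`, where `ℤ(4)` is discrete. -/
@[reducible]
def productTopology : TopologicalSpace StrongZ4Power :=
  @Pi.topologicalSpace ℕ (fun _ => ZMod 4) (fun _ => ⊥)

/-- The coarsest topology that is finer than the product topology and makes all homomorphisms
to the discrete group `ℤ(2)` continuous. (In Mathlib's order, finer topologies are smaller.) -/
noncomputable instance : TopologicalSpace StrongZ4Power :=
  productTopology ⊓ ⨅ f : StrongZ4Power →+ ZMod 2, TopologicalSpace.induced f ⊥

end StrongZ4Power

/-!
Write `A = ℤ(4)^ω` and `K = Hom(A, ℝ/ℤ)`, a compact group under pointwise convergence, of exponent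
`4`. The group `G = H^*` is the subgroup of `K` generated by the coordinate characters and by all
characters of order at most `2`; all that matters below is that `K[2] ⊆ G`, that `G` separates the
points of `A`, and that `χ ∘ 2` is continuous for the product topology whenever `χ ∈ G`.

*Minimality* (`isMinimalAddGroup_of_isEmbedding_compact`). Let `φ : G → Q` be a continuous bijective
homomorphism onto a Hausdorff group. Since `G[2] = K[2]` is compact, `φ` is a homeomorphism on it,
and by compactness of `K` the doubling map of `G` is open onto its image, which lies in `G[2]`.
If `φ g` is small then so is `φ (2g)`, hence `2g` is small in `G`, hence `2g = 2h` with `h` small in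
`G`; now `φ (g - h)` is small and `g - h ∈ G[2]`, so `g - h` and therefore `g` are small in `G`.

*Quotients.* Let `L` be a closed subgroup of `G` with `G/L` infinite, and let `B ≤ A` be its
annihilator. Duality for finite groups shows that `L` is in turn the set of characters in `G` that
vanish on `B` (`mem_of_forall_annihilator`), so `B` is infinite. The subgroup
`B ∩ 2A` of `B` is compact in the product topology, because `χ ∘ 2`
is continuous there; it is infinite because `A[2] = 2A`, so it contains a Cantor set and `#B ≥ 𝔠`
(`StrongZ4Power.continuum_le_mk_annihilator`). Finally every `b ∈ B` defines a character of `G/L`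
with open kernel, and only finitely many of these vanish on a given neighbourhood of zero. Hence
every neighbourhood base at zero of `G/L` has at least `𝔠` members (`continuum_le_mk_of_basis`),
which bounds the weight and excludes metrizability.
-/

open Filter Topology
open scoped Pointwise

/-! ### A minimality criterion for subgroups of compact groups of exponent four -/

/-- A subgroup `G` of a compact Hausdorff abelian group `K` of exponent dividing `4` is minimal as
soon as it contains all elements of `K` of order at most `2`. -/
theorem isMinimalAddGroup_of_isEmbedding_compact {G K : Type*} [AddCommGroup G] [TopologicalSpace G]
    [AddCommGroup K] [TopologicalSpace K] [IsTopologicalAddGroup K] [CompactSpace K] [T2Space K]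
    (ι : G →+ K) (hι : IsEmbedding ι) (h4 : ∀ k : K, 2 • (2 • k) = 0)
    (h2 : ∀ k : K, 2 • k = 0 → k ∈ Set.range ι) : IsMinimalAddGroup G := by
  have hG : IsTopologicalAddGroup G := hι.toIsInducing.topologicalAddGroup ι
  have hT : T2Space G := hι.t2Space
  refine ⟨hG, hT, ?_⟩
  intro Q _ _ _ _ φ hφ hbij
  have hclosed2 : IsClosed {k : K | 2 • k = 0} := isClosed_eq (by fun_prop) continuous_const
  have hN : IsCompact {g : G | 2 • g = 0} := by
    rw [hι.isCompact_iff]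
    convert hclosed2.isCompact using 1
    ext k
    constructor
    · rintro ⟨g, hg, rfl⟩
      change 2 • ι g = 0
      rw [← map_nsmul, show 2 • g = 0 from hg, map_zero]
    · intro hk
      obtain ⟨g, rfl⟩ := h2 k hk
      refine ⟨g, hι.injective ?_, rfl⟩
      simpa [map_nsmul] using hk
  -- On the compact subgroup `G[2]` the given topology agrees with the one induced by `φ`.
  have small : ∀ U ∈ 𝓝 (0 : G), ∃ W ∈ 𝓝 (0 : Q), ∀ n : G, 2 • n = 0 → φ n ∈ W → n ∈ U := by
    intro U hU
    have hc : IsClosed (φ '' ({g : G | 2 • g = 0} \ interior U)) :=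
      ((hN.diff isOpen_interior).image hφ).isClosed
    refine ⟨_, hc.isOpen_compl.mem_nhds ?_, ?_⟩
    · rintro ⟨g, ⟨-, hg⟩, h0⟩
      have : g = 0 := hbij.1 (by simpa using h0)
      exact hg (this ▸ mem_interior_iff_mem_nhds.2 hU)
    · intro n hn hW
      by_contra hnU
      exact hW ⟨n, ⟨hn, fun h => hnU (interior_subset h)⟩, rfl⟩
  -- Doubling is open onto its image, because `K` is compact and `G` contains `K[2]`.
  have double : ∀ V ∈ 𝓝 (0 : G), ∃ O ∈ 𝓝 (0 : G), ∀ g : G, 2 • g ∈ O →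
      ∃ h ∈ V, 2 • h = 2 • g := by
    intro V hV
    rw [hι.toIsInducing.nhds_eq_comap, map_zero] at hV
    obtain ⟨V', hV', hVV⟩ := hV
    have hc : IsClosed ((fun k : K => 2 • k) ''
        (interior V' + {k : K | 2 • k = 0})ᶜ) :=
      ((isOpen_interior.add_right).isClosed_compl.isCompact.image (continuous_nsmul 2)).isClosed
    refine ⟨ι ⁻¹' _, hι.continuous.continuousAt.preimage_mem_nhds
      (hc.isOpen_compl.mem_nhds ?_), ?_⟩
    · rintro ⟨k, hk, hk0⟩
      rw [map_zero] at hk0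
      exact hk ⟨0, mem_interior_iff_mem_nhds.2 hV', k, hk0, zero_add k⟩
    · intro g hg
      have : ι g ∈ interior V' + {k : K | 2 • k = 0} := by
        by_contra hcon
        exact hg ⟨ι g, hcon, (map_nsmul ι 2 g).symm⟩
      obtain ⟨u, hu, k, hk, huk⟩ := this
      obtain ⟨n, rfl⟩ := h2 k hk
      refine ⟨g - n, hVV ?_, ?_⟩
      · have : ι (g - n) = u := by rw [map_sub, ← huk]; simp
        rw [Set.mem_preimage, this]
        exact interior_subset hu
      · have : 2 • n = 0 := hι.injective (by simpa [map_nsmul] using hk)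
        rw [smul_sub, this, sub_zero]
  have h4G : ∀ g : G, 2 • (2 • g) = 0 := fun g =>
    hι.injective (by simpa only [map_nsmul, map_zero] using h4 (ι g))
  refine (IsTopologicalAddGroup.isOpenMap_iff_nhds_zero (f := φ)).2 ?_
  intro S hS
  rw [mem_map] at hS
  obtain ⟨V, hV, hVS⟩ : ∃ V ∈ 𝓝 (0 : G), ∀ v ∈ V, ∀ w ∈ V, v + w ∈ φ ⁻¹' S :=
    exists_nhds_zero_half hS
  obtain ⟨W, hW, hWV⟩ := small V hV
  obtain ⟨W₁, hW₁, hWW⟩ : ∃ W₁ ∈ 𝓝 (0 : Q), ∀ v ∈ W₁, ∀ w ∈ W₁, v - w ∈ W :=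
    exists_nhds_half_neg hW
  obtain ⟨O, hO, hdO⟩ := double (V ∩ φ ⁻¹' W₁)
    (inter_mem hV (hφ.continuousAt.preimage_mem_nhds (by rwa [map_zero])))
  obtain ⟨P, hP, hPO⟩ := small O hO
  have hP2 : (fun q : Q => 2 • q) ⁻¹' P ∈ 𝓝 (0 : Q) :=
    (continuous_nsmul 2).continuousAt.preimage_mem_nhds (by simpa using hP)
  filter_upwards [hP2, hW₁] with q hqP hqW
  obtain ⟨g, rfl⟩ := hbij.2 q
  obtain ⟨h, ⟨hhV, hhW⟩, hh⟩ := hdO g (hPO _ (h4G g) (by simpa [map_nsmul] using hqP))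
  have hgh : g - h ∈ V := by
    refine hWV _ (by rw [smul_sub, hh, sub_self]) ?_
    rw [map_sub]
    exact hWW _ hqW _ hhW
  simpa using hVS _ hgh _ hhV

/-! ### Infinite closed subgroups of compact metrizable groups -/

/-- By homogeneity, an infinite compact group has no isolated point, so in the metrizable case it
is perfect and contains a Cantor set. -/
theorem continuum_le_mk_of_isClosed_addSubgroup {X : Type*} [AddGroup X] [TopologicalSpace X]
    [IsTopologicalAddGroup X] [CompactSpace X] [TopologicalSpace.MetrizableSpace X]
    (B : AddSubgroup X) (hB : IsClosed (B : Set X)) (hinf : Infinite B) : 𝔠 ≤ #B := by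
  let := TopologicalSpace.metrizableSpaceMetric X
  obtain ⟨x, hxB, hx⟩ := (Set.infinite_coe_iff.1 hinf).exists_accPt_of_subset_isCompact
    hB.isCompact subset_rfl
  have hacc : ∀ y ∈ (B : Set X), AccPt y (𝓟 (B : Set X)) := by
    intro y hy
    rw [accPt_iff_nhds] at hx ⊢
    intro U hU
    have hU' : (fun z => y + (-x + z)) ⁻¹' U ∈ 𝓝 x :=
      ContinuousAt.preimage_mem_nhds (by fun_prop) (by simpa using hU)
    obtain ⟨z, ⟨hzU, hzB⟩, hzx⟩ := hx _ hU'
    refine ⟨y + (-x + z), ⟨hzU, B.add_mem hy (B.add_mem (B.neg_mem hxB) hzB)⟩, ?_⟩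
    intro h
    exact hzx (by simpa [neg_add_eq_zero, eq_comm] using h)
  obtain ⟨f, hfB, -, hf⟩ := (Perfect.mk hB hacc).exists_nat_bool_injection ⟨x, hxB⟩
  have := Cardinal.lift_mk_le_lift_mk_of_injective (f := fun s => (⟨f s, hfB ⟨s, rfl⟩⟩ : B))
    (fun s t h => hf (congrArg Subtype.val h))
  simpa using this

/-! ### Torsion characters -/

/-- Duality for `(ℤ/n)^ι`: a vector outside a subgroup `R` is separated from it by a linear form
with integer coefficients. -/
theorem exists_dotProduct_ne_zero_of_notMem {ι : Type*} [Fintype ι] {n : ℕ} [NeZero n]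
    (R : AddSubgroup (ι → ZMod n)) {v : ι → ZMod n} (hv : v ∉ R) :
    ∃ m : ι → ℕ, (∀ w ∈ R, ∑ i, (m i : ZMod n) * w i = 0) ∧ ∑ i, (m i : ZMod n) * v i ≠ 0 := by
  classical
  have hn : 0 < n := Nat.pos_of_neZero n
  obtain ⟨c, hc⟩ := CharacterModule.exists_character_apply_ne_zero_of_ne_zero
    (a := (v : (ι → ZMod n) ⧸ R)) (by rwa [ne_eq, QuotientAddGroup.eq_zero_iff])
  let c' : (ι → ZMod n) →+ AddCircle (1 : ℚ) :=
    AddMonoidHom.comp (c : ((ι → ZMod n) ⧸ R) →+ AddCircle (1 : ℚ)) (QuotientAddGroup.mk' R)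
  -- A character takes values in the multiples of the element `u = 1/n`, of order `n`, so its values
  -- on the standard basis are the coefficients of the form sought.
  let u : AddCircle (1 : ℚ) := ((1 / n : ℚ) : AddCircle (1 : ℚ))
  have hu : addOrderOf u = n := AddCircle.addOrderOf_period_div hn
  have hm : ∀ i, ∃ m : ℕ, c' (Pi.single i 1) = m • u := by
    intro i
    have h0 : n • c' (Pi.single i 1) = 0 := by
      rw [← map_nsmul, ← Pi.single_smul]
      simp
    obtain ⟨m, -, hm⟩ := (AddCircle.nsmul_eq_zero_iff (p := (1 : ℚ)) hn).1 h0
    refine ⟨m, hm.symm.trans ?_⟩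
    rw [← AddCircle.coe_nsmul]
    congr 1
    rw [nsmul_eq_mul]
    ring
  choose m hm using hm
  have key : ∀ w, c' w = 0 ↔ ∑ i, (m i : ZMod n) * w i = 0 := by
    intro w
    have hw : c' w = (∑ i, m i * (w i).val) • u := by
      conv_lhs => rw [← Finset.univ_sum_single w]
      rw [map_sum, Finset.sum_smul]
      refine Finset.sum_congr rfl fun i _ => ?_
      rw [mul_comm, mul_smul, ← hm, ← map_nsmul, ← Pi.single_smul]
      simp
    rw [hw, ← addOrderOf_dvd_iff_nsmul_eq_zero, hu, ← ZMod.natCast_eq_zero_iff]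
    simp
  refine ⟨m, fun w hw => (key w).1 ?_, fun h => hc ((key v).2 h)⟩
  change c (w : (ι → ZMod n) ⧸ R) = 0
  rw [(QuotientAddGroup.eq_zero_iff w).2 hw]
  exact map_zero (c : ((ι → ZMod n) ⧸ R) →+ AddCircle (1 : ℚ))

/-- The `n`-torsion of `ℝ/ℤ` is the image of `ZMod n`. -/
theorem exists_toAddCircle_eq {n : ℕ} [NeZero n] {t : UnitAddCircle} (ht : n • t = 0) :
    ∃ j : ZMod n, ZMod.toAddCircle j = t := by
  obtain ⟨m, -, hm⟩ := (AddCircle.nsmul_eq_zero_iff (p := (1 : ℝ)) (Nat.pos_of_neZero n)).1 ht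
  refine ⟨(m : ZMod n), ?_⟩
  rw [ZMod.toAddCircle_natCast, ← hm, mul_one]

theorem exists_mem_nhds_forall_nsmul_eq_zero {n : ℕ} (hn : 0 < n) :
    ∃ U ∈ 𝓝 (0 : UnitAddCircle), ∀ t ∈ U, n • t = 0 → t = 0 := by
  have hfin : ({t : UnitAddCircle | n • t = 0} \ {0}).Finite :=
    (AddCircle.finite_torsion (1 : ℝ) hn).sdiff
  refine ⟨_, hfin.isClosed.isOpen_compl.mem_nhds (by simp), fun t ht h => ?_⟩
  by_contra h0
  exact ht ⟨h, h0⟩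

/-! ### The dual group: neighbourhoods and annihilators -/

namespace ComfortRossDual

universe u

variable {A : Type*} [AddCommGroup A] [TopologicalSpace A]

/-- The inclusion of `A^*` into the group `A → ℝ/ℤ` of all functions. -/
def toFun : ComfortRossDual A →+ (A → UnitAddCircle) where
  toFun χ := χ
  map_zero' := rfl
  map_add' _ _ := rfl

theorem isInducing_coe : IsInducing (fun (χ : ComfortRossDual A) (a : A) => χ a) := ⟨rfl⟩

theorem eq_of_forall_apply {χ ψ : ComfortRossDual A} (h : ∀ a, χ a = ψ a) : χ = ψ :=
  DFunLike.ext (F := A →ₜ+ UnitAddCircle) χ ψ h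

instance : AddMonoidHomClass (ComfortRossDual A) A UnitAddCircle :=
  inferInstanceAs (AddMonoidHomClass (A →ₜ+ UnitAddCircle) A UnitAddCircle)

instance : ContinuousMapClass (ComfortRossDual A) A UnitAddCircle :=
  inferInstanceAs (ContinuousMapClass (A →ₜ+ UnitAddCircle) A UnitAddCircle)

instance : IsTopologicalAddGroup (ComfortRossDual A) :=
  isInducing_coe.topologicalAddGroup (toFun (A := A))

/-- Evaluation at `a`, as a homomorphism on `A^*`. -/
def eval (a : A) : ComfortRossDual A →+ UnitAddCircle where
  toFun χ := χ a
  map_zero' := rfl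
  map_add' _ _ := rfl

theorem continuous_eval (a : A) : Continuous (eval a) :=
  (continuous_apply a).comp isInducing_coe.continuous

theorem nsmul_apply_eq_zero {n : ℕ} (hA : ∀ a : A, n • a = 0) (χ : ComfortRossDual A) (a : A) :
    n • χ a = 0 := by
  rw [← map_nsmul, hA, map_zero]

/-- For characters of a group of exponent dividing `n`, whose values lie in a finite group, a basic
neighbourhood of `χ` consists of the characters that agree with `χ` on a finite set. -/
theorem mem_nhds_iff_exists_finset {n : ℕ} (hn : 0 < n) (hA : ∀ a : A, n • a = 0)
    {χ : ComfortRossDual A} {U : Set (ComfortRossDual A)} :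
    U ∈ 𝓝 χ ↔ ∃ F : Finset A, ∀ ψ : ComfortRossDual A, (∀ a ∈ F, ψ a = χ a) → ψ ∈ U := by
  constructor
  · intro hU
    rw [isInducing_coe.nhds_eq_comap, mem_comap] at hU
    obtain ⟨V, hV, hVU⟩ := hU
    rw [nhds_pi, mem_pi] at hV
    obtain ⟨I, hI, t, ht, htV⟩ := hV
    refine ⟨hI.toFinset, fun ψ hψ => hVU (htV fun a ha => ?_)⟩
    change ψ a ∈ t a
    rw [hψ a (hI.mem_toFinset.2 ha)]
    exact mem_of_mem_nhds (ht a)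
  · rintro ⟨F, hF⟩
    obtain ⟨W, hW, hW0⟩ := exists_mem_nhds_forall_nsmul_eq_zero hn
    have : ∀ᶠ ψ in 𝓝 χ, ∀ a ∈ F, ψ a - χ a ∈ W := by
      rw [Filter.eventually_all_finset]
      intro a _
      have hc : Continuous fun ψ : ComfortRossDual A => ψ a - χ a :=
        (continuous_eval a).sub continuous_const
      exact hc.continuousAt.preimage_mem_nhds (by simpa using hW)
    filter_upwards [this] with ψ hψ
    refine hF ψ fun a ha => sub_eq_zero.1 (hW0 _ (hψ a ha) ?_)
    rw [smul_sub, nsmul_apply_eq_zero hA, nsmul_apply_eq_zero hA, sub_zero]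

/-- The annihilator in `A` of a subgroup of `A^*`. -/
def annihilator (L : AddSubgroup (ComfortRossDual A)) : AddSubgroup A where
  carrier := {a | ∀ χ ∈ L, χ a = 0}
  zero_mem' χ _ := map_zero χ
  add_mem' ha hb χ hχ := by rw [map_add, ha χ hχ, hb χ hχ, add_zero]
  neg_mem' ha χ hχ := by rw [map_neg, ha χ hχ, neg_zero]

/-- A closed subgroup `L` of `A^*` contains every character that vanishes on the annihilator
of `L`. A character `χ ∉ L` is told from `L` by finitely many points of `A`; by duality for finite
groups a combination of these points is annihilated by `L` but not by `χ`. -/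
theorem mem_of_forall_annihilator {n : ℕ} [NeZero n] (hA : ∀ a : A, n • a = 0)
    {L : AddSubgroup (ComfortRossDual A)} (hL : IsClosed (L : Set (ComfortRossDual A)))
    {χ : ComfortRossDual A} (hχ : ∀ a ∈ annihilator L, χ a = 0) : χ ∈ L := by
  by_contra hmem
  obtain ⟨F, hF⟩ := (mem_nhds_iff_exists_finset (Nat.pos_of_neZero n) hA).1
    (hL.isOpen_compl.mem_nhds hmem)
  let r : ComfortRossDual A →+ (F → UnitAddCircle) :=
    { toFun := fun ψ a => ψ a, map_zero' := rfl, map_add' := fun _ _ => rfl }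
  let j : (F → ZMod n) →+ (F → UnitAddCircle) := (ZMod.toAddCircle (N := n)).compLeft F
  -- Restrictions to `F` take values in the `n`-torsion of `ℝ/ℤ`, that is, in `ZMod n`.
  have hj : ∀ ψ : ComfortRossDual A, ∃ v : F → ZMod n, j v = r ψ := by
    intro ψ
    choose v hv using fun a : F => exists_toAddCircle_eq (nsmul_apply_eq_zero hA ψ a)
    exact ⟨v, funext hv⟩
  obtain ⟨v, hv⟩ := hj χ
  have hvR : v ∉ (L.map r).comap j := by
    rintro ⟨ψ, hψL, hψ⟩
    refine hF ψ (fun a ha => ?_) hψL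
    exact congrFun (hψ.trans hv) ⟨a, ha⟩
  obtain ⟨m, hm, hmv⟩ := exists_dotProduct_ne_zero_of_notMem _ hvR
  have key : ∀ (ψ : ComfortRossDual A) (w : F → ZMod n), j w = r ψ →
      ψ (∑ a : F, m a • (a : A)) = ZMod.toAddCircle (∑ a, (m a : ZMod n) * w a) := by
    intro ψ w hw
    rw [map_sum, map_sum]
    refine Finset.sum_congr rfl fun a _ => ?_
    rw [map_nsmul, ← nsmul_eq_mul, map_nsmul]
    exact congrArg _ (congrFun hw a).symm
  refine hmv (ZMod.toAddCircle_injective n ?_)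
  rw [map_zero, ← key χ v hv]
  refine hχ _ fun ψ hψ => ?_
  obtain ⟨w, hw⟩ := hj ψ
  rw [key ψ w hw, hm w ⟨ψ, hψ, hw.symm⟩, map_zero]

theorem finite_quotient_of_finite_annihilator {n : ℕ} [NeZero n] (hA : ∀ a : A, n • a = 0)
    {L : AddSubgroup (ComfortRossDual A)} (hL : IsClosed (L : Set (ComfortRossDual A)))
    (hfin : Finite (annihilator L)) : Finite (ComfortRossDual A ⧸ L) := by
  have : Finite {t : UnitAddCircle | n • t = 0} :=
    (AddCircle.finite_torsion (1 : ℝ) (Nat.pos_of_neZero n)).to_subtype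
  let f : ComfortRossDual A → annihilator L → {t : UnitAddCircle | n • t = 0} :=
    fun χ b => ⟨χ b, nsmul_apply_eq_zero hA χ b⟩
  refine Finite.of_injective (fun q : ComfortRossDual A ⧸ L => f q.out) fun p q h => ?_
  rw [← QuotientAddGroup.out_eq' p, ← QuotientAddGroup.out_eq' q, QuotientAddGroup.eq]
  refine mem_of_forall_annihilator hA hL fun a ha => ?_
  have := congrArg Subtype.val (congrFun h ⟨a, ha⟩)
  change p.out a = q.out a at this
  change -(p.out a) + q.out a = 0
  rw [this, neg_add_cancel]

/-- Only finitely many elements of `A` vanish, as characters of `A^*`, on a given neighbourhood `U`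
of zero. The reason is precompactness: `U` contains an open subgroup of finite index. -/
theorem finite_setOf_forall_eq_zero {n : ℕ} (hn : 0 < n) (hA : ∀ a : A, n • a = 0)
    (hsep : ∀ a : A, (∀ χ : ComfortRossDual A, χ a = 0) → a = 0)
    {U : Set (ComfortRossDual A)} (hU : U ∈ 𝓝 0) :
    {a : A | ∀ χ ∈ U, χ a = 0}.Finite := by
  have : Finite {t : UnitAddCircle | n • t = 0} := (AddCircle.finite_torsion (1 : ℝ) hn).to_subtype
  obtain ⟨F, hF⟩ := (mem_nhds_iff_exists_finset hn hA).1 hU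
  let r : ComfortRossDual A → F → {t : UnitAddCircle | n • t = 0} :=
    fun χ a => ⟨χ a, nsmul_apply_eq_zero hA χ a⟩
  have hfin : Finite (Set.range r) := inferInstance
  -- An element `a` of the set is determined by its values on representatives of the finitely
  -- many restrictions of characters to `F`.
  choose s hs using fun p : Set.range r => p.2
  let e : {a : A | ∀ χ ∈ U, χ a = 0} → Set.range r → {t : UnitAddCircle | n • t = 0} :=
    fun a p => ⟨s p a, nsmul_apply_eq_zero hA (s p) a⟩
  suffices he : Function.Injective e by
    have := Finite.of_injective e he
    exact Set.toFinite _
  refine fun a b hab => Subtype.ext ?_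
  rw [← sub_eq_zero]
  refine hsep _ fun χ => ?_
  have h := congrArg Subtype.val (congrFun hab ⟨r χ, χ, rfl⟩)
  set ψ := s ⟨r χ, χ, rfl⟩ with hψ
  change ψ a = ψ b at h
  have hU : χ - ψ ∈ U := by
    refine hF _ fun c hc => ?_
    have := congrArg Subtype.val (congrFun (hs ⟨r χ, χ, rfl⟩) ⟨c, hc⟩)
    change ψ c = χ c at this
    change χ c - ψ c = 0
    rw [this, sub_self]
  have ha : χ a - ψ a = 0 := a.2 _ hU
  have hb : χ b - ψ b = 0 := b.2 _ hU
  rw [map_sub, sub_eq_zero.1 ha, sub_eq_zero.1 hb, h, sub_self]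

/-! ### Neighbourhood bases of quotients of the dual group -/

/-- Each element of the annihilator of `L` is a character of `A^* / L` whose kernel is open; sending
it to a member of the base contained in that kernel is a map with finite fibres. -/
theorem mk_annihilator_le {A : Type u} [AddCommGroup A] [TopologicalSpace A]
    {n : ℕ} (hn : 0 < n) (hA : ∀ a : A, n • a = 0)
    (hsep : ∀ a : A, (∀ χ : ComfortRossDual A, χ a = 0) → a = 0)
    (L : AddSubgroup (ComfortRossDual A)) {ι : Type u} (V : ι → Set (ComfortRossDual A ⧸ L))
    (hV : ∀ i, V i ∈ 𝓝 0) (hbasis : ∀ U ∈ 𝓝 (0 : ComfortRossDual A ⧸ L), ∃ i, V i ⊆ U) :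
    #(annihilator L) ≤ #ι * ℵ₀ := by
  have hker : ∀ b : annihilator L, ∃ i, V i ⊆ (↑) '' {χ : ComfortRossDual A | χ b = 0} := by
    intro b
    have h0 : {χ : ComfortRossDual A | χ b = 0} ∈ 𝓝 (0 : ComfortRossDual A) :=
      (mem_nhds_iff_exists_finset hn hA).2 ⟨{(b : A)}, fun χ h => h b (Finset.mem_singleton_self _)⟩
    exact hbasis _ (QuotientAddGroup.isOpenMap_coe.image_mem_nhds h0)
  choose f hf using hker
  refine Cardinal.mk_le_mk_mul_of_mk_preimage_le f fun i => ?_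
  have hpre : ((↑) : ComfortRossDual A → ComfortRossDual A ⧸ L) ⁻¹' V i ∈
      𝓝 (0 : ComfortRossDual A) :=
    continuous_quot_mk.continuousAt.preimage_mem_nhds (hV i)
  have hfin := finite_setOf_forall_eq_zero hn hA hsep hpre
  refine (Set.Finite.lt_aleph0 ((hfin.preimage Subtype.val_injective.injOn).subset ?_)).le
  rintro b rfl χ hχ
  obtain ⟨ψ, hψ, hψχ⟩ := hf b hχ
  have hL : -ψ + χ ∈ L := QuotientAddGroup.eq.1 hψχ
  have h : -ψ b + χ b = 0 := b.2 _ hL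
  rwa [show ψ b = 0 from hψ, neg_zero, zero_add] at h

theorem continuum_le_mk_of_basis {A : Type u} [AddCommGroup A] [TopologicalSpace A]
    {n : ℕ} (hn : 0 < n) (hA : ∀ a : A, n • a = 0)
    (hsep : ∀ a : A, (∀ χ : ComfortRossDual A, χ a = 0) → a = 0)
    (L : AddSubgroup (ComfortRossDual A)) (hL : 𝔠 ≤ #(annihilator L)) {ι : Type u}
    (V : ι → Set (ComfortRossDual A ⧸ L))
    (hV : ∀ i, V i ∈ 𝓝 0) (hbasis : ∀ U ∈ 𝓝 (0 : ComfortRossDual A ⧸ L), ∃ i, V i ⊆ U) :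
    𝔠 ≤ #ι := by
  by_contra! hlt
  exact (Cardinal.mul_lt_of_lt Cardinal.aleph0_le_continuum hlt
    Cardinal.aleph0_lt_continuum).not_ge (hL.trans (mk_annihilator_le hn hA hsep L V hV hbasis))

theorem continuum_le_topologicalWeight_quotient {A : Type*} [AddCommGroup A] [TopologicalSpace A]
    {n : ℕ} (hn : 0 < n) (hA : ∀ a : A, n • a = 0)
    (hsep : ∀ a : A, (∀ χ : ComfortRossDual A, χ a = 0) → a = 0)
    (L : AddSubgroup (ComfortRossDual A)) (hL : 𝔠 ≤ #(annihilator L)) :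
    𝔠 ≤ topologicalWeight (ComfortRossDual A ⧸ L) := by
  refine le_csInf ⟨_, _, TopologicalSpace.isTopologicalBasis_opens, rfl⟩ ?_
  rintro _ ⟨B, hB, rfl⟩
  refine (continuum_le_mk_of_basis hn hA hsep L hL
    (fun V : {V : Set (ComfortRossDual A ⧸ L) // V ∈ B ∧ 0 ∈ V} => V.1)
    (fun V => hB.mem_nhds V.2.1 V.2.2) fun U hU => ?_).trans
    (Cardinal.mk_le_mk_of_subset fun V hV => hV.1)
  obtain ⟨V, hVB, h0, hVU⟩ := hB.mem_nhds_iff.1 hU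
  exact ⟨⟨V, hVB, h0⟩, hVU⟩

theorem not_metrizableSpace_quotient {A : Type*} [AddCommGroup A] [TopologicalSpace A]
    {n : ℕ} (hn : 0 < n) (hA : ∀ a : A, n • a = 0)
    (hsep : ∀ a : A, (∀ χ : ComfortRossDual A, χ a = 0) → a = 0)
    (L : AddSubgroup (ComfortRossDual A)) (hL : 𝔠 ≤ #(annihilator L)) :
    ¬ TopologicalSpace.MetrizableSpace (ComfortRossDual A ⧸ L) := by
  intro
  obtain ⟨V, hV⟩ := (𝓝 (0 : ComfortRossDual A ⧸ L)).exists_antitone_basis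
  have h := continuum_le_mk_of_basis hn hA hsep L hL (fun i : ULift ℕ => V i.down)
    (fun i => hV.mem i.down) fun U hU => by
      obtain ⟨i, -, hi⟩ := hV.toHasBasis.mem_iff.1 hU
      exact ⟨⟨i⟩, hi⟩
  exact (Cardinal.mk_le_aleph0.trans_lt Cardinal.aleph0_lt_continuum).not_ge h

/-! ### Minimality of the dual group -/

/-- The dual of a group `A` of exponent dividing `4` is minimal if all characters of `A` of order at
most `2` are continuous: it embeds into the compact group of all characters of `A`. -/
theorem isMinimalAddGroup (hA : ∀ a : A, 4 • a = 0)
    (hcont : ∀ f : A →+ UnitAddCircle, (∀ a, 2 • f a = 0) → Continuous f) :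
    IsMinimalAddGroup (ComfortRossDual A) := by
  let K : AddSubgroup (A → UnitAddCircle) :=
    { carrier := Set.range ((↑) : (A →+ UnitAddCircle) → A → UnitAddCircle)
      zero_mem' := ⟨0, rfl⟩
      add_mem' := by
        rintro _ _ ⟨f, rfl⟩ ⟨g, rfl⟩
        exact ⟨f + g, rfl⟩
      neg_mem' := by
        rintro _ ⟨f, rfl⟩
        exact ⟨-f, rfl⟩ }
  have hK : IsClosed (K : Set (A → UnitAddCircle)) :=
    AddMonoidHom.isClosed_range_coe A UnitAddCircle
  have : CompactSpace K := isCompact_iff_compactSpace.1 hK.isCompact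
  -- The inclusion of `A^*` into the compact group `K` of all characters of `A`.
  let ι : ComfortRossDual A →+ K :=
    (toFun (A := A)).codRestrict K fun χ => ⟨(χ : A →+ UnitAddCircle), rfl⟩
  have hι : IsEmbedding ι := by
    refine ⟨IsInducing.of_comp ?_ continuous_subtype_val isInducing_coe, fun χ ψ h => ?_⟩
    · exact Continuous.subtype_mk isInducing_coe.continuous _
    · exact eq_of_forall_apply fun a => congrFun (congrArg Subtype.val h) a
  refine isMinimalAddGroup_of_isEmbedding_compact ι hι ?_ ?_
  · rintro ⟨_, f, rfl⟩
    ext a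
    change 2 • (2 • f a) = 0
    rw [smul_smul, ← map_nsmul]
    exact (congrArg f (hA a)).trans (map_zero f)
  · rintro ⟨_, f, rfl⟩ hf
    have h2 : ∀ a, 2 • f a = 0 := fun a => congrFun (congrArg Subtype.val hf) a
    exact ⟨(⟨f, hcont f h2⟩ : A →ₜ+ UnitAddCircle), rfl⟩

end ComfortRossDual

/-! ### The group `ℤ(4)^ω` with the strengthened topology -/

namespace StrongZ4Power

theorem four_nsmul (a : StrongZ4Power) : 4 • a = 0 := by
  funext i
  change 4 • (a i : ZMod 4) = 0
  rw [nsmul_eq_mul]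
  exact (by decide : ∀ x : ZMod 4, ((4 : ℕ) : ZMod 4) * x = 0) (a i)

theorem continuous_toZMod_two (f : StrongZ4Power →+ ZMod 2) : Continuous f := by
  refine continuous_iff_le_induced.2 (inf_le_right.trans (iInf_le _ f))

theorem continuous_of_two_nsmul_eq_zero (f : StrongZ4Power →+ UnitAddCircle)
    (hf : ∀ a, 2 • f a = 0) : Continuous f := by
  choose g hg using fun a => exists_toAddCircle_eq (n := 2) (hf a)
  let g' : StrongZ4Power →+ ZMod 2 := AddMonoidHom.mk' g fun a b =>
    ZMod.toAddCircle_injective 2 (by simp only [map_add, hg])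
  have : (f : StrongZ4Power → UnitAddCircle) = ZMod.toAddCircle ∘ g' := funext fun a => (hg a).symm
  rw [this]
  exact continuous_of_discreteTopology.comp (continuous_toZMod_two g')

/-- The `i`-th coordinate as a continuous character, with `ℤ(4)` embedded into `ℝ/ℤ`. -/
noncomputable def coordChar (i : ℕ) : ComfortRossDual StrongZ4Power :=
  show StrongZ4Power →ₜ+ UnitAddCircle from
  { toFun := fun a => ZMod.toAddCircle (a i : ZMod 4)
    map_zero' := map_zero _
    map_add' := fun _ _ => map_add ZMod.toAddCircle _ _
    continuous_toFun := by
      have h : Continuous[productTopology, _] fun a : StrongZ4Power => (a i : ZMod 4) :=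
        continuous_apply (A := fun _ : ℕ => ZMod 4) i
      exact continuous_of_discreteTopology.comp (continuous_le_dom inf_le_left h) }

theorem eq_zero_of_forall_character (a : StrongZ4Power)
    (ha : ∀ χ : ComfortRossDual StrongZ4Power, χ a = 0) : a = 0 :=
  funext fun i => ZMod.toAddCircle_injective 4
    ((ha (coordChar i)).trans (map_zero ZMod.toAddCircle).symm)

theorem coordChar_injective : Function.Injective coordChar := by
  intro i j h
  have h' := congrArg (fun χ : ComfortRossDual StrongZ4Power =>
    χ (Pi.single i (1 : ZMod 4) : ℕ → ZMod 4)) h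
  have : (Pi.single i (1 : ZMod 4) : ℕ → ZMod 4) i = (Pi.single i (1 : ZMod 4) : ℕ → ZMod 4) j :=
    ZMod.toAddCircle_injective 4 h'
  by_contra hne
  rw [Pi.single_eq_same, Pi.single_eq_of_ne (Ne.symm hne)] at this
  exact absurd this (by decide)

/-- The group `StrongZ4Power` without its topology, identified with `ℕ → ZMod 4`, which carries
the product topology. -/
noncomputable def toPi : StrongZ4Power ≃+ (ℕ → ZMod 4) := AddEquiv.refl (ℕ → ZMod 4)

/-- Doubling is continuous from the product topology to the strengthened one, because every
homomorphism to `ℤ(2)` vanishes on doubles. -/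
theorem continuous_toPi_symm_two_nsmul :
    Continuous fun a : ℕ → ZMod 4 => toPi.symm (2 • a) := by
  refine continuous_iff_coinduced_le.2 (le_inf ?_ (le_iInf fun f => ?_))
  · exact continuous_iff_coinduced_le.1 (continuous_nsmul (M := ℕ → ZMod 4) 2)
  · refine continuous_iff_coinduced_le.1 (continuous_induced_rng.2 ?_)
    have : f ∘ (fun a : ℕ → ZMod 4 => toPi.symm (2 • a)) = fun _ => 0 := by
      funext a
      rw [Function.comp_apply, map_nsmul, map_nsmul]
      exact CharTwo.two_nsmul _
    rw [this]
    exact continuous_const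

theorem exists_two_nsmul_eq {a : StrongZ4Power} (ha : 2 • a = 0) :
    ∃ b : StrongZ4Power, 2 • b = a := by
  have h : ∀ x : ZMod 4, 2 • x = 0 → ∃ y : ZMod 4, 2 • y = x := by decide
  choose b hb using fun i => h (a i) (congrFun ha i)
  exact ⟨b, funext hb⟩

/-- The elements `2a` of the annihilator form a subgroup `T` that is compact in the product
topology; `T` is infinite if the annihilator is, since `A[2] = 2A`. -/
theorem continuum_le_mk_annihilator (L : AddSubgroup (ComfortRossDual StrongZ4Power))
    (hinf : Infinite (ComfortRossDual.annihilator L)) :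
    𝔠 ≤ #(ComfortRossDual.annihilator L) := by
  set B := ComfortRossDual.annihilator L
  let S : AddSubgroup (ℕ → ZMod 4) :=
    B.comap (toPi.symm.toAddMonoidHom.comp (nsmulAddMonoidHom 2))
  have hS : IsClosed (S : Set (ℕ → ZMod 4)) := by
    have : (S : Set (ℕ → ZMod 4)) = ⋂ χ ∈ L, {a | χ (toPi.symm (2 • a)) = 0} := by
      ext a
      simp only [Set.mem_iInter]
      rfl
    rw [this]
    exact isClosed_biInter fun χ _ =>
      isClosed_eq ((map_continuous χ).comp continuous_toPi_symm_two_nsmul) continuous_const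
  let T : AddSubgroup (ℕ → ZMod 4) := S.map (nsmulAddMonoidHom 2)
  have hT : IsClosed (T : Set (ℕ → ZMod 4)) :=
    (hS.isCompact.image (continuous_nsmul 2)).isClosed
  have hTB : ∀ x ∈ T, toPi.symm x ∈ B := by
    rintro _ ⟨a, ha, rfl⟩
    exact ha
  have hBT : ∀ b, 2 • b ∈ B → toPi (2 • b) ∈ T := by
    intro b hb
    refine ⟨toPi b, ?_, (map_nsmul toPi 2 b).symm⟩
    change toPi.symm (2 • toPi b) ∈ B
    rwa [← map_nsmul, AddEquiv.symm_apply_apply]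
  have hTinf : Infinite T := by
    refine not_finite_iff_infinite.1 fun hfin => ?_
    have hTfin : (T : Set (ℕ → ZMod 4)).Finite := Set.toFinite _
    refine Set.infinite_coe_iff.1 hinf
      (Set.Finite.of_finite_fibers (fun b => toPi (2 • b)) (hTfin.subset ?_) fun c hc => ?_)
    · rintro _ ⟨b, hb, rfl⟩
      exact hBT b (B.nsmul_mem hb 2)
    · -- Points of a fibre differ by an element of `B[2]`, which is a double and so lies in `T`.
      obtain ⟨b, hb, rfl⟩ := hc
      have hinj : Function.Injective fun x => toPi (x - b) :=
        toPi.injective.comp (sub_left_injective)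
      refine (hTfin.preimage hinj.injOn).subset ?_
      rintro x ⟨hx, hxb⟩
      obtain ⟨y, hy⟩ := exists_two_nsmul_eq (a := x - b)
        (by rw [smul_sub, sub_eq_zero]; exact toPi.injective hxb)
      change toPi (x - b) ∈ T
      rw [← hy]
      exact hBT y (hy ▸ B.sub_mem hx hb)
  exact (continuum_le_mk_of_isClosed_addSubgroup T hT hTinf).trans
    (Cardinal.mk_le_of_injective (f := fun x : T => (⟨toPi.symm x, hTB x x.2⟩ : B))
      fun x y h => Subtype.ext (toPi.symm.injective (by simpa only [Subtype.mk.injEq] using h)))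

end StrongZ4Power

theorem mainTheorem9 :
    IsMinimalAddGroup (ComfortRossDual StrongZ4Power) ∧
    Infinite (ComfortRossDual StrongZ4Power) ∧
    (∀ L : AddSubgroup (ComfortRossDual StrongZ4Power),
      IsClosed (L : Set (ComfortRossDual StrongZ4Power)) →
      Infinite (ComfortRossDual StrongZ4Power ⧸ L) →
      𝔠 ≤ topologicalWeight (ComfortRossDual StrongZ4Power ⧸ L)) ∧
    (∀ L : AddSubgroup (ComfortRossDual StrongZ4Power),
      IsClosed (L : Set (ComfortRossDual StrongZ4Power)) →
      Infinite (ComfortRossDual StrongZ4Power ⧸ L) →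
      ¬ TopologicalSpace.MetrizableSpace (ComfortRossDual StrongZ4Power ⧸ L)) := by
  have large : ∀ L : AddSubgroup (ComfortRossDual StrongZ4Power),
      IsClosed (L : Set (ComfortRossDual StrongZ4Power)) →
      Infinite (ComfortRossDual StrongZ4Power ⧸ L) →
      𝔠 ≤ #(ComfortRossDual.annihilator L) := by
    intro L hL hinf
    refine StrongZ4Power.continuum_le_mk_annihilator L (not_finite_iff_infinite.1 fun hfin => ?_)
    exact not_finite_iff_infinite.2 hinf (ComfortRossDual.finite_quotient_of_finite_annihilator
      StrongZ4Power.four_nsmul hL hfin)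
  refine ⟨ComfortRossDual.isMinimalAddGroup StrongZ4Power.four_nsmul
      StrongZ4Power.continuous_of_two_nsmul_eq_zero,
    Infinite.of_injective _ StrongZ4Power.coordChar_injective, fun L hL hinf => ?_,
    fun L hL hinf => ?_⟩
  · exact ComfortRossDual.continuum_le_topologicalWeight_quotient four_pos
      StrongZ4Power.four_nsmul StrongZ4Power.eq_zero_of_forall_character L (large L hL hinf)
  · exact ComfortRossDual.not_metrizableSpace_quotient four_pos
      StrongZ4Power.four_nsmul StrongZ4Power.eq_zero_of_forall_character L (large L hL hinf)
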